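/- **Notation.** For a real matrix $X$, let $|X|_1=\sum_{i,j}|X_{ij}|$, let $|X|_2$ be the Frobenius norm, $\|X\|$ the spectral norm, and $\sigma_k(X)$ the $k$-th largest singular value. Let $M\in\mathbb{R}^{m\times n}$, $r\le\min\{m,n\}$, and let $U,V$ range over $\mathbb{R}^{m\times r}$ and $\mathbb{R}^{n\times r}$. Put $\mathrm{OPT}=\min_{U,V}|M-UV^\top|_1$, and let $X^\star=U^\star V^{\star\top}$ be a product attaining this minimum. Assume $\mathrm{OPT}>0$ and $X^\star\ne 0$. Let $\varepsilon>0$ and $$\tau=\frac{\varepsilon\,\mathrm{OPT}}{3mn},\qquad \lambda=\frac{2\varepsilon\,\mathrm{OPT}}{3|X^\star|_2^2},\qquad \widehat L=\frac1\tau+\lambda,$$ $$f(X)=\sum_{i,j}\tau\Big(\sqrt{\big((M_{ij}-X_{ij})/\tau\big)^2+1}-1\Big)+\frac{\lambda}{2}|X|_2^2 .$$ Let $\widehat X^\star=\widehat U^\star\widehat V^{\star\top}$ be the product of any minimizer of $(U,V)\mapsto f(UV^\top)$. It has rank at most $r$, so it equals its best rank-$r$ approximation $\widehat X^\star_r$.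 **Algorithm (BFGD on $f$, with $\gamma=\tfrac14$ and $C=1$).** Let $X_0=-\tfrac1{\widehat L}\nabla f(0)$ have singular value decomposition $A\Sigma B^\top$ with decreasing singular values, and set $U_0=A_r\Sigma_r^{1/2}$, $V_0=B_r\Sigma_r^{1/2}$, where the subscript $r$ keeps the $r$ leading singular triples. For $i=0,\dots,T-1$, with $G_i=\nabla f(U_iV_i^\top)$ and $D_i=U_i^\top U_i-V_i^\top V_i$, choose any $\eta_i>0$ with $$\eta_i\Big(15\widehat L\,\big\|\begin{bmatrix}U_i\\V_i\end{bmatrix}\big\|^2+3\|G_i\|\Big)\le 1$$ and set $$U_{i+1}=U_i-\eta_i\big(G_iV_i+\gamma U_iD_i\big),\qquad V_{i+1}=V_i-\eta_i\big(G_i^\top U_i-\gamma V_iD_i\big).$$ **Initialization condition.** Let $\mathrm{Dist}(U,V;X)$ be the minimum of $\left|\begin{bmatrix}U\\V\end{bmatrix}-\begin{bmatrix}\tilde U\\ \tilde V\end{bmatrix}\right|_2$ over all $\tilde U\in\mathbb{R}^{m\times r},\tilde V\in\mathbb{R}^{n\times r}$ with $\tilde U\tilde V^\top=X$ and $\sigma_i(\tilde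 U)=\sigma_i(\tilde V)=\sigma_i(X)^{1/2}$ for $1\le i\le r$. Assume $$\mathrm{Dist}(U_0,V_0;\widehat X^\star_r)\le\frac{\sqrt2\,\sigma_r(\widehat X^\star_r)^{1/2}}{10}.$$ **Theorem 5.1.** There is an absolute constant $K>0$ such that, in the setting above, with $$B=\sigma_r(\widehat X^\star_r)\left(\frac{mn}{(\varepsilon\,\mathrm{OPT})^2}+\frac1{|X^\star|_2^2}\right),$$ the output of the algorithm after $T=\lceil K B\rceil$ iterations satisfies $$|M-U_TV_T^\top|_1\le(1+\varepsilon)\,\mathrm{OPT}.$$ If moreover $\widehat L\ge\gamma=\tfrac14$, the same bound holds for every number $T\ge KB$ of iterations. -/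

import Mathlib

open scoped Matrix ENNReal

noncomputable section

namespace LowRankL1

/-- The entrywise `ℓ₁` norm. -/
def l1Norm {α β : Type*} [Fintype α] [Fintype β] (X : Matrix α β ℝ) : ℝ :=
  ∑ i, ∑ j, |X i j|

/-- The Frobenius norm. -/
def frobNorm {α β : Type*} [Fintype α] [Fintype β] (X : Matrix α β ℝ) : ℝ :=
  Real.sqrt (∑ i, ∑ j, X i j ^ 2)

open scoped Matrix.Norms.L2Operator in
/-- The spectral norm (largest singular value), as the `ℓ₂ → ℓ₂` operator norm. -/
def specNorm {α β : Type*} [Fintype α] [Fintype β] [DecidableEq β] (X : Matrix α β ℝ) : ℝ :=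
  ‖X‖

/-- The `k`-th largest singular value `σ_k(X)`, counted from `k = 1`. -/
def sigma {α β : Type*} [Fintype α] [Fintype β] [DecidableEq β]
    (X : Matrix α β ℝ) (k : ℕ) : ℝ :=
  (Matrix.toEuclideanLin X).singularValues (k - 1)

/-- The trace inner product `⟨X, Y⟩ = Tr (Xᵀ Y)`. -/
def matInner {m n : ℕ} (X Y : Matrix (Fin m) (Fin n) ℝ) : ℝ :=
  (Xᵀ * Y).trace

/-- The gradient of `f` at `X`, as the matrix of partial derivatives. -/
def matGrad {m n : ℕ} (f : Matrix (Fin m) (Fin n) ℝ → ℝ) (X : Matrix (Fin m) (Fin n) ℝ) :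
    Matrix (Fin m) (Fin n) ℝ :=
  Matrix.of fun i j => lineDeriv ℝ f X (Matrix.single i j 1)

/-- `f` is convex, differentiable, and `μ`-strongly convex. -/
def IsStronglyConvex {m n : ℕ} (f : Matrix (Fin m) (Fin n) ℝ → ℝ) (μ : ℝ) : Prop :=
  ConvexOn ℝ Set.univ f ∧ Differentiable ℝ f ∧
    ∀ X Y, f X + matInner (matGrad f X) (Y - X) + μ / 2 * frobNorm (Y - X) ^ 2 ≤ f Y

/-! ### The approximation problem and its smoothed version -/

/-- `OPT`, the optimal value of `min_{U, V} |M - U Vᵀ|₁`, where `U` is `m × r` and `V` is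
`n × r`. -/
def OPT {m n : ℕ} (r : ℕ) (M : Matrix (Fin m) (Fin n) ℝ) : ℝ :=
  ⨅ p : Matrix (Fin m) (Fin r) ℝ × Matrix (Fin n) (Fin r) ℝ, l1Norm (M - p.1 * p.2ᵀ)

/-- The Charbonnier function `h(x, τ)` on scalars. -/
def charbonnier (x τ : ℝ) : ℝ :=
  τ * (Real.sqrt ((x / τ) ^ 2 + 1) - 1)

/-- The Charbonnier function on matrices, summed over the entries. -/
def charbonnierMat {m n : ℕ} (X : Matrix (Fin m) (Fin n) ℝ) (τ : ℝ) : ℝ :=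
  ∑ i, ∑ j, charbonnier (X i j) τ

/-- The smoothed and regularized objective `f(X) = h(M - X, τ) + (λ/2) |X|₂²`. -/
def objective {m n : ℕ} (M : Matrix (Fin m) (Fin n) ℝ) (τ lam : ℝ)
    (X : Matrix (Fin m) (Fin n) ℝ) : ℝ :=
  charbonnierMat (M - X) τ + lam / 2 * frobNorm X ^ 2

/-- `(U, V)` is a minimizer of `f(U Vᵀ)` over all pairs of factors of width `r`. -/
def IsFactorMinimizer {m n r : ℕ} (f : Matrix (Fin m) (Fin n) ℝ → ℝ)
    (U : Matrix (Fin m) (Fin r) ℝ) (V : Matrix (Fin n) (Fin r) ℝ) : Prop :=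
  ∀ (U' : Matrix (Fin m) (Fin r) ℝ) (V' : Matrix (Fin n) (Fin r) ℝ),
    f (U * Vᵀ) ≤ f (U' * V'ᵀ)

/-! ### Distance between factors -/

/-- The set of equally-footed factorizations `X = U Vᵀ`: the `i`-th singular values of `U` and of
`V` are both the square root of the `i`-th singular value of `X`, for `i = 1, …, r`. -/
def equallyFooted {m n : ℕ} (r : ℕ) (X : Matrix (Fin m) (Fin n) ℝ) :
    Set (Matrix (Fin m) (Fin r) ℝ × Matrix (Fin n) (Fin r) ℝ) :=
  {p | p.1 * p.2ᵀ = X ∧ ∀ i : Fin r,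
    sigma p.1 (i + 1) = Real.sqrt (sigma X (i + 1)) ∧
    sigma p.2 (i + 1) = Real.sqrt (sigma X (i + 1))}

/-- `Dist(U, V; X)`: the Frobenius distance of the stacked matrix `[U; V]` to the equally-footed
factorizations of `X`. It takes values in `[0, ∞]`, so that an empty set of factorizations would
be at distance `∞`; for `X` of rank at most `r` the set is not empty. -/
def Dist {m n r : ℕ} (U : Matrix (Fin m) (Fin r) ℝ) (V : Matrix (Fin n) (Fin r) ℝ)
    (X : Matrix (Fin m) (Fin n) ℝ) : ℝ≥0∞ :=
  ⨅ p ∈ equallyFooted r X,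
    ENNReal.ofReal (frobNorm (Matrix.fromRows U V - Matrix.fromRows p.1 p.2))

/-! ### Bi-factored gradient descent -/

/-- `U = A_r Σ_r^{1/2}` and `V = B_r Σ_r^{1/2}` for a singular value decomposition
`X = A Σ Bᵀ` (thin form, singular values in decreasing order), where the subscript `r` keeps the
`r` leading singular triples. So `U Vᵀ` is a best rank-`r` approximation of `X`, and it is `X`
itself when `rank X ≤ r`. -/
def IsSVDFactorization {m n r : ℕ} (hr : r ≤ min m n) (X : Matrix (Fin m) (Fin n) ℝ)
    (U : Matrix (Fin m) (Fin r) ℝ) (V : Matrix (Fin n) (Fin r) ℝ) : Prop :=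
  ∃ (A : Matrix (Fin m) (Fin (min m n)) ℝ) (B : Matrix (Fin n) (Fin (min m n)) ℝ)
    (s : Fin (min m n) → ℝ),
    Aᵀ * A = 1 ∧ Bᵀ * B = 1 ∧ (∀ k, 0 ≤ s k) ∧ Antitone s ∧
    X = A * Matrix.diagonal s * Bᵀ ∧
    (∀ i j, U i j = Real.sqrt (s (Fin.castLE hr j)) * A i (Fin.castLE hr j)) ∧
    (∀ i j, V i j = Real.sqrt (s (Fin.castLE hr j)) * B i (Fin.castLE hr j))

/-- Rule 1: a gradient step of size `η` on the factors. -/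
def rule1 {m n r : ℕ} (f : Matrix (Fin m) (Fin n) ℝ → ℝ) (η : ℝ)
    (U : Matrix (Fin m) (Fin r) ℝ) (V : Matrix (Fin n) (Fin r) ℝ) :
    Matrix (Fin m) (Fin r) ℝ × Matrix (Fin n) (Fin r) ℝ :=
  (U - η • (matGrad f (U * Vᵀ) * V), V - η • ((matGrad f (U * Vᵀ))ᵀ * U))

/-- Rule 2: a gradient step of size `η` with the balancing term of weight `γ`. -/
def rule2 {m n r : ℕ} (f : Matrix (Fin m) (Fin n) ℝ → ℝ) (γ η : ℝ)
    (U : Matrix (Fin m) (Fin r) ℝ) (V : Matrix (Fin n) (Fin r) ℝ) :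
    Matrix (Fin m) (Fin r) ℝ × Matrix (Fin n) (Fin r) ℝ :=
  (U - η • (matGrad f (U * Vᵀ) * V + γ • (U * (Uᵀ * U - Vᵀ * V))),
   V - η • ((matGrad f (U * Vᵀ))ᵀ * U - γ • (V * (Uᵀ * U - Vᵀ * V))))

open scoped Classical in
/-- The update of the factors: Rule 2 if `f` is strongly convex, and Rule 1 otherwise. -/
def bfgdUpdate {m n r : ℕ} (f : Matrix (Fin m) (Fin n) ℝ → ℝ) (γ η : ℝ)
    (U : Matrix (Fin m) (Fin r) ℝ) (V : Matrix (Fin n) (Fin r) ℝ) :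
    Matrix (Fin m) (Fin r) ℝ × Matrix (Fin n) (Fin r) ℝ :=
  if ∃ μ : ℝ, 0 < μ ∧ IsStronglyConvex f μ then rule2 f γ η U V else rule1 f η U V

/-- `(U₀, V₀), …, (U_T, V_T)` are the iterates of a run of `BFGD(r, T, γ, C, L̂)` on `f` with step
sizes `η₀, …, η_{T-1}`. The condition
`η ≤ C / (15 L̂ ‖[U; V]‖² + 3 ‖∇f(U Vᵀ)‖)` is written without the division. -/
structure IsBFGDRun {m n r : ℕ} (f : Matrix (Fin m) (Fin n) ℝ → ℝ) (hr : r ≤ min m n)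
    (T : ℕ) (γ C Lhat : ℝ) (η : ℕ → ℝ)
    (U : ℕ → Matrix (Fin m) (Fin r) ℝ) (V : ℕ → Matrix (Fin n) (Fin r) ℝ) : Prop where
  init : IsSVDFactorization hr ((1 / Lhat) • (-matGrad f 0)) (U 0) (V 0)
  step_pos : ∀ i < T, 0 < η i
  step_le : ∀ i < T,
    η i * (15 * Lhat * specNorm (Matrix.fromRows (U i) (V i)) ^ 2
      + 3 * specNorm (matGrad f (U i * (V i)ᵀ))) ≤ C
  update : ∀ i < T, (U (i + 1), V (i + 1)) = bfgdUpdate f γ (η i) (U i) (V i)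

end LowRankL1

end

/-! No rate of convergence is needed: the initialization condition already makes the starting point
good enough, and the iteration only has to do no harm.

Write `e = ε * OPT` and `S = √(mn) / L̂`. The entries of `∇f(0)` have modulus at most one, so the
starting product and the squared spectral norms of its factors are at most `S` (`initial_size_le`).
The distance condition is relative to `σ_r(X̂)^{1/2}`, which is itself controlled by the starting
factors, so `X₀ = U₀V₀ᵀ` lies within `2/5 * S` of `X̂` and `σ_r(X̂) ≤ 7/5 * S` (`initial_error_le`).
Since `h(·, τ)` is 1-Lipschitz and `1/L̂ ≤ τ`, this gives `f(X₀) ≤ f(X̂) + mnτ = f(X̂) + e/3`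
(`objective_le_of_close`).

Rule 2 is gradient descent on `f(UVᵀ) + γ/4 * |UᵀU - VᵀV|₂²`, and the step-size bound makes this
merit function nonincreasing when `γ ≤ L̂` (`balancedObjective_rule2_le`). The starting factors are
balanced, so the merit function starts at `f(X₀)` and `f` never exceeds that value
(`IsBFGDRun.apply_le`). If `L̂ < 1/4`, the bound on `σ_r(X̂)` forces `B ≤ 1`; hence there is at most
one step, and at balanced factors the balancing term vanishes, so the weight may be taken to be
zero.

The total error is three times `e/3`: smoothing, regularization at `X*`, and the starting point. -/

open scoped Matrix ENNReal

noncomputable section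

namespace LowRankL1

/-! ### Frobenius and spectral norms, trace inner product, singular values. -/

section Norms

set_option linter.unusedSectionVars false

variable {α β ρ : Type*} [Fintype α] [Fintype β] [Fintype ρ]

/-- The entries of a matrix as a vector of a Euclidean space. -/
def toVec (A : Matrix α β ℝ) : EuclideanSpace ℝ (α × β) := WithLp.toLp 2 fun p => A p.1 p.2

/-- The trace inner product, for arbitrary index types. -/
def trInner (A B : Matrix α β ℝ) : ℝ := ∑ i, ∑ j, A i j * B i j

lemma frobNorm_eq_norm (A : Matrix α β ℝ) : frobNorm A = ‖toVec A‖ := by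
  simp [frobNorm, EuclideanSpace.norm_eq, toVec, Fintype.sum_prod_type]

lemma trInner_eq_inner (A B : Matrix α β ℝ) : trInner A B = inner ℝ (toVec A) (toVec B) := by
  simp [trInner, toVec, PiLp.inner_apply, Fintype.sum_prod_type, mul_comm]

lemma trInner_eq_trace (A B : Matrix α β ℝ) : trInner A B = (Aᵀ * B).trace := by
  simp only [trInner, Matrix.trace, Matrix.diag, Matrix.mul_apply, Matrix.transpose_apply]
  exact Finset.sum_comm

lemma frobNorm_nonneg (A : Matrix α β ℝ) : 0 ≤ frobNorm A := Real.sqrt_nonneg _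

lemma frobNorm_sq (A : Matrix α β ℝ) : frobNorm A ^ 2 = ∑ i, ∑ j, A i j ^ 2 :=
  Real.sq_sqrt (by positivity)

lemma trInner_self (A : Matrix α β ℝ) : trInner A A = frobNorm A ^ 2 := by
  rw [frobNorm_sq]
  simp only [trInner, sq]

lemma frobNorm_add_le (A B : Matrix α β ℝ) : frobNorm (A + B) ≤ frobNorm A + frobNorm B := by
  simp only [frobNorm_eq_norm]
  exact norm_add_le (toVec A) (toVec B)

lemma frobNorm_neg (A : Matrix α β ℝ) : frobNorm (-A) = frobNorm A := by
  simp [frobNorm]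

lemma frobNorm_sub_le (A B : Matrix α β ℝ) : frobNorm (A - B) ≤ frobNorm A + frobNorm B := by
  simpa only [sub_eq_add_neg, frobNorm_neg] using frobNorm_add_le A (-B)

lemma frobNorm_smul (c : ℝ) (A : Matrix α β ℝ) : frobNorm (c • A) = |c| * frobNorm A := by
  have h : toVec (c • A) = c • toVec A := rfl
  simp [frobNorm_eq_norm, h, norm_smul]

lemma frobNorm_transpose (A : Matrix α β ℝ) : frobNorm Aᵀ = frobNorm A := by
  simp only [frobNorm, Matrix.transpose_apply]
  rw [Finset.sum_comm]

lemma trInner_le (A B : Matrix α β ℝ) : trInner A B ≤ frobNorm A * frobNorm B := by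
  simpa only [trInner_eq_inner, frobNorm_eq_norm] using real_inner_le_norm (toVec A) (toVec B)

lemma frobNorm_add_sq (A B : Matrix α β ℝ) :
    frobNorm (A + B) ^ 2 = frobNorm A ^ 2 + 2 * trInner A B + frobNorm B ^ 2 := by
  simp only [trInner_eq_inner, frobNorm_eq_norm]
  exact norm_add_sq_real (toVec A) (toVec B)

lemma trInner_add_right (A B C : Matrix α β ℝ) :
    trInner A (B + C) = trInner A B + trInner A C := by
  simp [trInner_eq_trace, Matrix.mul_add]

lemma trInner_sub_right (A B C : Matrix α β ℝ) :
    trInner A (B - C) = trInner A B - trInner A C := by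
  simp [trInner_eq_trace, Matrix.mul_sub]

lemma trInner_add_left (A B C : Matrix α β ℝ) :
    trInner (A + B) C = trInner A C + trInner B C := by
  simp [trInner_eq_trace, Matrix.add_mul]

lemma trInner_sub_left (A B C : Matrix α β ℝ) :
    trInner (A - B) C = trInner A C - trInner B C := by
  simp [trInner_eq_trace, Matrix.sub_mul]

lemma trInner_smul_right (c : ℝ) (A B : Matrix α β ℝ) :
    trInner A (c • B) = c * trInner A B := by
  simp [trInner_eq_trace]

lemma trInner_smul_left (c : ℝ) (A B : Matrix α β ℝ) :
    trInner (c • A) B = c * trInner A B := by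
  simp [trInner_eq_trace]

lemma trInner_comm (A B : Matrix α β ℝ) : trInner A B = trInner B A := by
  simp [trInner, mul_comm]

lemma trInner_transpose (A B : Matrix α β ℝ) : trInner Aᵀ Bᵀ = trInner A B := by
  simp only [trInner, Matrix.transpose_apply]
  exact Finset.sum_comm

lemma trInner_mul_right (A : Matrix α β ℝ) (B : Matrix α ρ ℝ) (C : Matrix ρ β ℝ) :
    trInner A (B * C) = trInner (A * Cᵀ) B := by
  rw [trInner_eq_trace, trInner_eq_trace, Matrix.transpose_mul, Matrix.transpose_transpose,
    ← Matrix.mul_assoc, Matrix.trace_mul_comm, ← Matrix.mul_assoc]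

lemma trInner_mul_left (A : Matrix α β ℝ) (B : Matrix α ρ ℝ) (C : Matrix ρ β ℝ) :
    trInner A (B * C) = trInner (Bᵀ * A) C := by
  rw [trInner_eq_trace, trInner_eq_trace, Matrix.transpose_mul, Matrix.transpose_transpose,
    ← Matrix.mul_assoc]

lemma frobNorm_fromRows_sq (U : Matrix α ρ ℝ) (V : Matrix β ρ ℝ) :
    frobNorm (Matrix.fromRows U V) ^ 2 = frobNorm U ^ 2 + frobNorm V ^ 2 := by
  simp [frobNorm_sq]

variable [DecidableEq α] [DecidableEq β] [DecidableEq ρ]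

lemma specNorm_nonneg (A : Matrix α β ℝ) : 0 ≤ specNorm A := by
  open scoped Matrix.Norms.L2Operator in exact norm_nonneg A

lemma norm_mulVec_le_specNorm (A : Matrix α β ℝ) (x : β → ℝ) :
    ‖WithLp.toLp 2 (A *ᵥ x)‖ ≤ specNorm A * ‖WithLp.toLp 2 x‖ :=
  Matrix.l2_opNorm_mulVec A (WithLp.toLp 2 x)

lemma specNorm_le_of_forall {A : Matrix α β ℝ} {c : ℝ} (hc : 0 ≤ c)
    (h : ∀ x : β → ℝ, ‖WithLp.toLp 2 (A *ᵥ x)‖ ≤ c * ‖WithLp.toLp 2 x‖) : specNorm A ≤ c := by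
  rw [specNorm, Matrix.l2_opNorm_def]
  exact ContinuousLinearMap.opNorm_le_bound _ hc fun x => h x.ofLp

lemma specNorm_transpose (A : Matrix α β ℝ) : specNorm Aᵀ = specNorm A := by
  rw [← Matrix.conjTranspose_eq_transpose_of_trivial]
  exact Matrix.l2_opNorm_conjTranspose A

lemma specNorm_transpose_mul_self (A : Matrix α β ℝ) : specNorm (Aᵀ * A) = specNorm A ^ 2 := by
  rw [sq, ← Matrix.conjTranspose_eq_transpose_of_trivial]
  exact Matrix.l2_opNorm_conjTranspose_mul_self A

lemma specNorm_mul_le (A : Matrix α β ℝ) (B : Matrix β ρ ℝ) :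
    specNorm (A * B) ≤ specNorm A * specNorm B :=
  Matrix.l2_opNorm_mul A B

lemma specNorm_add_le (A B : Matrix α β ℝ) : specNorm (A + B) ≤ specNorm A + specNorm B := by
  open scoped Matrix.Norms.L2Operator in exact norm_add_le A B

lemma specNorm_sub_le (A B : Matrix α β ℝ) : specNorm (A - B) ≤ specNorm A + specNorm B := by
  open scoped Matrix.Norms.L2Operator in exact norm_sub_le A B

lemma specNorm_smul (c : ℝ) (A : Matrix α β ℝ) : specNorm (c • A) = |c| * specNorm A := by
  open scoped Matrix.Norms.L2Operator in exact norm_smul c A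

lemma frobNorm_mul_le_left (A : Matrix α β ℝ) (B : Matrix β ρ ℝ) :
    frobNorm (A * B) ≤ specNorm A * frobNorm B := by
  refine le_of_sq_le_sq ?_ (mul_nonneg (specNorm_nonneg A) (frobNorm_nonneg B))
  rw [mul_pow, frobNorm_sq, frobNorm_sq, Finset.sum_comm, Finset.sum_comm (s := Finset.univ (α := β)),
    Finset.mul_sum]
  refine Finset.sum_le_sum fun k _ => ?_
  have h := pow_le_pow_left₀ (norm_nonneg _) (norm_mulVec_le_specNorm A fun j => B j k) 2
  rw [mul_pow, EuclideanSpace.norm_sq_eq, EuclideanSpace.norm_sq_eq] at h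
  simpa [Matrix.mul_apply, Matrix.mulVec, dotProduct] using h

lemma frobNorm_mul_le_right (A : Matrix α β ℝ) (B : Matrix β ρ ℝ) :
    frobNorm (A * B) ≤ frobNorm A * specNorm B := by
  rw [← frobNorm_transpose, Matrix.transpose_mul, ← specNorm_transpose B, ← frobNorm_transpose A,
    mul_comm]
  exact frobNorm_mul_le_left _ _

lemma specNorm_le_frobNorm (A : Matrix α β ℝ) : specNorm A ≤ frobNorm A := by
  refine specNorm_le_of_forall (frobNorm_nonneg A) fun x => ?_
  refine le_of_sq_le_sq ?_ (mul_nonneg (frobNorm_nonneg A) (norm_nonneg _))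
  rw [mul_pow, EuclideanSpace.norm_sq_eq, EuclideanSpace.norm_sq_eq, frobNorm_sq, Finset.sum_mul]
  refine Finset.sum_le_sum fun i _ => ?_
  simpa [Matrix.mulVec, dotProduct] using Finset.sum_mul_sq_le_sq_mul_sq Finset.univ (A i) x

lemma specNorm_top_le_fromRows (U : Matrix α ρ ℝ) (V : Matrix β ρ ℝ) :
    specNorm U ≤ specNorm (Matrix.fromRows U V) := by
  refine specNorm_le_of_forall (specNorm_nonneg _) fun x => ?_
  refine le_trans ?_ (norm_mulVec_le_specNorm (Matrix.fromRows U V) x)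
  refine le_of_sq_le_sq ?_ (norm_nonneg _)
  simp only [EuclideanSpace.norm_sq_eq, Matrix.fromRows_mulVec, Fintype.sum_sum_type,
    Sum.elim_inl, Sum.elim_inr]
  exact le_add_of_nonneg_right (by positivity)

lemma specNorm_bot_le_fromRows (U : Matrix α ρ ℝ) (V : Matrix β ρ ℝ) :
    specNorm V ≤ specNorm (Matrix.fromRows U V) := by
  refine specNorm_le_of_forall (specNorm_nonneg _) fun x => ?_
  refine le_trans ?_ (norm_mulVec_le_specNorm (Matrix.fromRows U V) x)
  refine le_of_sq_le_sq ?_ (norm_nonneg _)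
  simp only [EuclideanSpace.norm_sq_eq, Matrix.fromRows_mulVec, Fintype.sum_sum_type,
    Sum.elim_inl, Sum.elim_inr]
  exact le_add_of_nonneg_left (by positivity)

lemma sigma_nonneg (A : Matrix α β ℝ) (k : ℕ) : 0 ≤ sigma A k :=
  LinearMap.singularValues_nonneg _ _

/-- An eigenvector `x` of `TᵀT` for the eigenvalue `σ²` satisfies `‖Tx‖ = σ‖x‖`. Beyond the
dimension of the domain, singular values are zero by convention. -/
lemma sigma_le_specNorm (A : Matrix α β ℝ) (k : ℕ) : sigma A k ≤ specNorm A := by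
  rw [sigma]
  set T := Matrix.toEuclideanLin A with hT
  rcases le_or_gt (Module.finrank ℝ (EuclideanSpace ℝ β)) (k - 1) with hk | hk
  · rw [T.singularValues_of_finrank_le hk]
    exact specNorm_nonneg A
  obtain ⟨x, hx⟩ := (T.hasEigenvalue_adjoint_comp_self_sq_singularValues hk).exists_hasEigenvector
  have hx0 : 0 < ‖x‖ := norm_pos_iff.mpr hx.2
  have h1 : ‖T x‖ ^ 2 = (T.singularValues (k - 1) * ‖x‖) ^ 2 := by
    have h2 := hx.apply_eq_smul
    rw [← real_inner_self_eq_norm_sq, ← LinearMap.adjoint_inner_left]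
    rw [LinearMap.comp_apply] at h2
    rw [h2]
    simp [real_inner_smul_left, mul_pow]
  have h3 : ‖T x‖ ≤ specNorm A * ‖x‖ := norm_mulVec_le_specNorm A x.ofLp
  have h4 := (pow_left_inj₀ (norm_nonneg _)
    (mul_nonneg (T.singularValues_nonneg _) hx0.le) two_ne_zero).mp h1
  exact le_of_mul_le_mul_right (h4 ▸ h3) hx0

end Norms

/-! ### The Charbonnier function: derivative, smoothness, comparison with `|x|`. -/

section Charbonnier

/-- With `s`, `t` the roots at `a`, `b`, the tangent at `a` plus `(b - a)² / (2s)` equals `(s² + t²)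
/ (2s)`, which is at least `t` by AM-GM; finally `s ≥ 1`. Rescaling yields the smoothness constant
`1/τ`. -/
lemma sqrt_sq_add_one_le (a b : ℝ) :
    √(b ^ 2 + 1) ≤ √(a ^ 2 + 1) + a / √(a ^ 2 + 1) * (b - a) + (b - a) ^ 2 / 2 := by
  set s := √(a ^ 2 + 1) with hs
  set t := √(b ^ 2 + 1) with ht
  have hs2 : s ^ 2 = a ^ 2 + 1 := Real.sq_sqrt (by positivity)
  have ht2 : t ^ 2 = b ^ 2 + 1 := Real.sq_sqrt (by positivity)
  have hs1 : 1 ≤ s := Real.one_le_sqrt.mpr (by nlinarith)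
  have hs0 : 0 < s := by linarith
  have h1 : t ≤ s + a / s * (b - a) + (b - a) ^ 2 / (2 * s) := by
    have : s + a / s * (b - a) + (b - a) ^ 2 / (2 * s) = (s ^ 2 + t ^ 2) / (2 * s) := by
      rw [ht2]
      field_simp
      linear_combination hs2
    rw [this, le_div_iff₀ (by positivity)]
    nlinarith [sq_nonneg (s - t)]
  have h2 : (b - a) ^ 2 / (2 * s) ≤ (b - a) ^ 2 / 2 := by
    gcongr
    linarith
  linarith

/-- The derivative of the Charbonnier function. -/
def charbonnierDeriv (x τ : ℝ) : ℝ := x / τ / √((x / τ) ^ 2 + 1)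

lemma hasDerivAt_charbonnier {τ : ℝ} (hτ : τ ≠ 0) (x : ℝ) :
    HasDerivAt (fun y => charbonnier y τ) (charbonnierDeriv x τ) x := by
  have h1 : HasDerivAt (fun y : ℝ => (y / τ) ^ 2 + 1) (2 * (x / τ) * (1 / τ)) x := by
    simpa using (((hasDerivAt_id x).div_const τ).pow 2).add_const 1
  have h2 := ((h1.sqrt (by positivity)).sub_const 1).const_mul τ
  have hs : √((x / τ) ^ 2 + 1) ≠ 0 := by positivity
  refine h2.congr_deriv ?_
  rw [charbonnierDeriv]
  field_simp

lemma abs_charbonnierDeriv_le (x τ : ℝ) : |charbonnierDeriv x τ| ≤ 1 := by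
  rw [charbonnierDeriv, abs_div, abs_of_nonneg (Real.sqrt_nonneg _)]
  refine div_le_one_of_le₀ ?_ (Real.sqrt_nonneg _)
  exact Real.abs_le_sqrt (by linarith)

lemma charbonnier_le_quadratic {τ : ℝ} (hτ : 0 < τ) (x y : ℝ) :
    charbonnier y τ ≤ charbonnier x τ + charbonnierDeriv x τ * (y - x)
      + 1 / τ / 2 * (y - x) ^ 2 := by
  have h := mul_le_mul_of_nonneg_left (sqrt_sq_add_one_le (x / τ) (y / τ)) hτ.le
  have e : τ * (√((x / τ) ^ 2 + 1) + x / τ / √((x / τ) ^ 2 + 1) * (y / τ - x / τ)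
      + (y / τ - x / τ) ^ 2 / 2) = τ * √((x / τ) ^ 2 + 1)
      + x / τ / √((x / τ) ^ 2 + 1) * (y - x) + 1 / τ / 2 * (y - x) ^ 2 := by
    have hs : √((x / τ) ^ 2 + 1) ≠ 0 := by positivity
    generalize √((x / τ) ^ 2 + 1) = s at *
    field_simp
  rw [e] at h
  simp only [charbonnier, charbonnierDeriv]
  linarith

lemma charbonnier_le_abs {τ : ℝ} (hτ : 0 < τ) (x : ℝ) : charbonnier x τ ≤ |x| := by
  have h : √((x / τ) ^ 2 + 1) ≤ |x| / τ + 1 := by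
    rw [Real.sqrt_le_left (by positivity)]
    have : (|x| / τ) ^ 2 = (x / τ) ^ 2 := by rw [div_pow, div_pow, sq_abs]
    nlinarith [show 0 ≤ |x| / τ by positivity]
  calc τ * (√((x / τ) ^ 2 + 1) - 1) ≤ τ * (|x| / τ) := by gcongr; linarith
    _ = |x| := by field_simp

lemma abs_le_charbonnier_add {τ : ℝ} (hτ : 0 < τ) (x : ℝ) : |x| ≤ charbonnier x τ + τ := by
  have h : |x / τ| ≤ √((x / τ) ^ 2 + 1) := Real.abs_le_sqrt (by linarith)
  rw [abs_div, abs_of_pos hτ, div_le_iff₀ hτ] at h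
  rw [charbonnier]
  linarith

lemma sqrt_sq_add_one_sub_le (a b : ℝ) : √(a ^ 2 + 1) ≤ √(b ^ 2 + 1) + |a - b| := by
  rw [Real.sqrt_le_left (by positivity)]
  have h1 : |b| ≤ √(b ^ 2 + 1) := Real.abs_le_sqrt (by linarith)
  have h2 : √(b ^ 2 + 1) ^ 2 = b ^ 2 + 1 := Real.sq_sqrt (by positivity)
  have h3 : b * (a - b) ≤ √(b ^ 2 + 1) * |a - b| :=
    (le_abs_self _).trans (by rw [abs_mul]; gcongr)
  nlinarith [sq_abs (a - b)]

lemma charbonnier_sub_le {τ : ℝ} (hτ : 0 < τ) (x y : ℝ) :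
    charbonnier x τ ≤ charbonnier y τ + |x - y| := by
  have h := mul_le_mul_of_nonneg_left (sqrt_sq_add_one_sub_le (x / τ) (y / τ)) hτ.le
  rw [← sub_div, abs_div, abs_of_pos hτ, mul_add, mul_div_cancel₀ _ hτ.ne'] at h
  simp only [charbonnier]
  linarith

variable {m n : ℕ}

lemma charbonnierMat_le_l1Norm {τ : ℝ} (hτ : 0 < τ) (X : Matrix (Fin m) (Fin n) ℝ) :
    charbonnierMat X τ ≤ l1Norm X :=
  Finset.sum_le_sum fun _ _ => Finset.sum_le_sum fun _ _ => charbonnier_le_abs hτ _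

lemma l1Norm_le_charbonnierMat_add {τ : ℝ} (hτ : 0 < τ) (X : Matrix (Fin m) (Fin n) ℝ) :
    l1Norm X ≤ charbonnierMat X τ + m * n * τ := by
  have h : l1Norm X ≤ ∑ i, ∑ j, (charbonnier (X i j) τ + τ) :=
    Finset.sum_le_sum fun _ _ => Finset.sum_le_sum fun _ _ => abs_le_charbonnier_add hτ _
  simpa [Finset.sum_add_distrib, charbonnierMat, mul_assoc] using h

lemma charbonnierMat_le_add_l1Norm {τ : ℝ} (hτ : 0 < τ) (X Y : Matrix (Fin m) (Fin n) ℝ) :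
    charbonnierMat X τ ≤ charbonnierMat Y τ + l1Norm (X - Y) := by
  simp only [charbonnierMat, l1Norm, ← Finset.sum_add_distrib]
  exact Finset.sum_le_sum fun _ _ => Finset.sum_le_sum fun _ _ => charbonnier_sub_le hτ _ _

lemma l1Norm_le_sqrt_mul_frobNorm (X : Matrix (Fin m) (Fin n) ℝ) :
    l1Norm X ≤ √(m * n) * frobNorm X := by
  refine le_of_sq_le_sq ?_ (mul_nonneg (Real.sqrt_nonneg _) (frobNorm_nonneg X))
  rw [mul_pow, Real.sq_sqrt (by positivity), frobNorm_sq, l1Norm, ← Fintype.sum_prod_type',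
    ← Fintype.sum_prod_type' (f := fun i j => X i j ^ 2)]
  simpa using sq_sum_le_card_mul_sum_sq (s := Finset.univ)
    (f := fun p : Fin m × Fin n => |X p.1 p.2|)

end Charbonnier

/-! ### Gradient and smoothness of the regularized objective. -/

section Objective

variable {m n : ℕ}

lemma matGrad_objective (M : Matrix (Fin m) (Fin n) ℝ) {τ : ℝ} (hτ : τ ≠ 0) (lam : ℝ)
    (X : Matrix (Fin m) (Fin n) ℝ) (i : Fin m) (j : Fin n) :
    matGrad (objective M τ lam) X i j =
      -charbonnierDeriv (M i j - X i j) τ + lam * X i j := by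
  -- The matrix unit stays opaque while differentiating, and is unfolded only to collapse the sums.
  obtain ⟨E, hE⟩ : ∃ E : Matrix (Fin m) (Fin n) ℝ, E = Matrix.single i j 1 := ⟨_, rfl⟩
  have key : ∀ k l, HasDerivAt (fun t : ℝ => (X + t • E) k l) (E k l) 0 := fun k l => by
    simpa using ((hasDerivAt_id (0 : ℝ)).mul_const (E k l)).const_add (X k l)
  have h1 : ∀ k l, HasDerivAt (fun t : ℝ => charbonnier ((M - (X + t • E)) k l) τ)
      (charbonnierDeriv (M k l - X k l) τ * -E k l) 0 := fun k l => by
    have h := (key k l).const_sub (M k l)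
    have h2 := hasDerivAt_charbonnier hτ (M k l - X k l)
    exact HasDerivAt.comp (0 : ℝ) (h₂ := fun y => charbonnier y τ) (by simpa using h2) h
  have h2 : ∀ k l, HasDerivAt (fun t : ℝ => (X + t • E) k l ^ 2)
      (2 * X k l * E k l) 0 := fun k l => by
    simpa using (key k l).fun_pow 2
  have h3 : HasDerivAt (fun t : ℝ => objective M τ lam (X + t • E))
      (∑ k, ∑ l, charbonnierDeriv (M k l - X k l) τ * -E k l +
        lam / 2 * ∑ k, ∑ l, 2 * X k l * E k l) 0 := by
    simp only [objective, frobNorm_sq, charbonnierMat]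
    exact (HasDerivAt.fun_sum fun k _ => HasDerivAt.fun_sum fun l _ => h1 k l).add
      ((HasDerivAt.fun_sum fun k _ => HasDerivAt.fun_sum fun l _ => h2 k l).const_mul _)
  have h4 : ∀ c : Fin m → Fin n → ℝ,
      ∑ k, ∑ l, c k l * E k l = c i j := fun c => by
    rw [Finset.sum_eq_single i, Finset.sum_eq_single j] <;>
      simp +contextual [hE, Matrix.single_apply, eq_comm]
  rw [matGrad, Matrix.of_apply, lineDeriv, ← hE, h3.deriv, h4]
  have h5 := h4 fun k l => -charbonnierDeriv (M k l - X k l) τ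
  simp only [mul_neg, neg_mul] at h5 ⊢
  rw [h5]
  ring

/-- The smoothness of the objective. -/
lemma objective_le_quadratic (M : Matrix (Fin m) (Fin n) ℝ) {τ : ℝ} (hτ : 0 < τ) (lam : ℝ)
    (X Y : Matrix (Fin m) (Fin n) ℝ) :
    objective M τ lam Y ≤ objective M τ lam X + trInner (matGrad (objective M τ lam) X) (Y - X)
      + (1 / τ + lam) / 2 * frobNorm (Y - X) ^ 2 := by
  have e : objective M τ lam X + trInner (matGrad (objective M τ lam) X) (Y - X)
      + (1 / τ + lam) / 2 * frobNorm (Y - X) ^ 2 =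
      ∑ i, ∑ j, (charbonnier (M i j - X i j) τ
        + charbonnierDeriv (M i j - X i j) τ * ((M i j - Y i j) - (M i j - X i j))
        + 1 / τ / 2 * ((M i j - Y i j) - (M i j - X i j)) ^ 2 + lam / 2 * Y i j ^ 2) := by
    simp only [objective, charbonnierMat, trInner, frobNorm_sq, Finset.mul_sum,
      ← Finset.sum_add_distrib]
    refine Finset.sum_congr rfl fun i _ => Finset.sum_congr rfl fun j _ => ?_
    rw [matGrad_objective M hτ.ne']
    simp only [Matrix.sub_apply]
    ring
  rw [e]
  simp only [objective, charbonnierMat, frobNorm_sq, Finset.mul_sum, ← Finset.sum_add_distrib]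
  refine Finset.sum_le_sum fun i _ => Finset.sum_le_sum fun j _ => ?_
  gcongr
  exact charbonnier_le_quadratic hτ _ _

lemma frobNorm_matGrad_objective_zero_le (M : Matrix (Fin m) (Fin n) ℝ) {τ : ℝ} (hτ : τ ≠ 0)
    (lam : ℝ) : frobNorm (matGrad (objective M τ lam) 0) ≤ √(m * n) := by
  refine Real.sqrt_le_sqrt ?_
  have h : ∀ i j, matGrad (objective M τ lam) 0 i j ^ 2 ≤ 1 := fun i j => by
    rw [matGrad_objective M hτ, sq_le_one_iff_abs_le_one]
    simpa using abs_charbonnierDeriv_le (M i j) τ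
  calc _ ≤ ∑ _i : Fin m, ∑ _j : Fin n, (1 : ℝ) :=
        Finset.sum_le_sum fun i _ => Finset.sum_le_sum fun j _ => h i j
    _ = m * n := by simp

end Objective

/-! ### One step of Rule 2 decreases the merit function. -/

section Descent

variable {m n r : ℕ}

/-- The merit function of Rule 2: the objective at `U Vᵀ` plus the imbalance of the factors. -/
def balancedObjective (f : Matrix (Fin m) (Fin n) ℝ → ℝ) (γ : ℝ)
    (U : Matrix (Fin m) (Fin r) ℝ) (V : Matrix (Fin n) (Fin r) ℝ) : ℝ :=
  f (U * Vᵀ) + γ / 4 * frobNorm (Uᵀ * U - Vᵀ * V) ^ 2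

/-- The scalar core of the descent step: `p`, `q` stand for the norms of the two gradient blocks,
`x` and `e` for the changes of product and imbalance, `c` and `d` for the second-order terms paired
with `G` and `D`. Everything of second order is absorbed by `-η(p² + q²)`. -/
lemma descent_arith {L γ η w g p q x e c d : ℝ} (hη : 0 < η) (hγ : 0 ≤ γ) (hγL : γ ≤ L)
    (hg : 0 ≤ g) (hx0 : 0 ≤ x) (he0 : 0 ≤ e)
    (hstep : η * (15 * L * w ^ 2 + 3 * g) ≤ 1)
    (hx : x ≤ 7 / 6 * (η * w * (p + q))) (he : e ≤ 7 / 3 * (η * w * (p + q)))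
    (hc : c ≤ g * (p * q)) (hd : d ≤ w ^ 2 * (p ^ 2 + q ^ 2)) :
    -η * (p ^ 2 + q ^ 2) + η ^ 2 * c + L / 2 * x ^ 2
      + γ / 2 * (η ^ 2 * d) + γ / 4 * e ^ 2 ≤ 0 := by
  have hL : 0 ≤ L := hγ.trans hγL
  have hN : 0 ≤ p ^ 2 + q ^ 2 := by positivity
  have h1 : (p + q) ^ 2 ≤ 2 * (p ^ 2 + q ^ 2) := by nlinarith [sq_nonneg (p - q)]
  have hx2 : x ^ 2 ≤ 49 / 18 * (η ^ 2 * (w ^ 2 * (p ^ 2 + q ^ 2))) := by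
    calc x ^ 2 ≤ (7 / 6 * (η * w * (p + q))) ^ 2 := pow_le_pow_left₀ hx0 hx 2
      _ = 49 / 36 * (η ^ 2 * (w ^ 2 * (p + q) ^ 2)) := by ring
      _ ≤ 49 / 36 * (η ^ 2 * (w ^ 2 * (2 * (p ^ 2 + q ^ 2)))) := by gcongr
      _ = _ := by ring
  have he2 : e ^ 2 ≤ 98 / 9 * (η ^ 2 * (w ^ 2 * (p ^ 2 + q ^ 2))) := by
    calc e ^ 2 ≤ (7 / 3 * (η * w * (p + q))) ^ 2 := pow_le_pow_left₀ he0 he 2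
      _ = 49 / 9 * (η ^ 2 * (w ^ 2 * (p + q) ^ 2)) := by ring
      _ ≤ 49 / 9 * (η ^ 2 * (w ^ 2 * (2 * (p ^ 2 + q ^ 2)))) := by gcongr
      _ = _ := by ring
  have hc2 : c ≤ g * ((p ^ 2 + q ^ 2) / 2) :=
    hc.trans (by gcongr; nlinarith [sq_nonneg (p - q)])
  calc _ ≤ -η * (p ^ 2 + q ^ 2) + η ^ 2 * (g * ((p ^ 2 + q ^ 2) / 2))
        + L / 2 * (49 / 18 * (η ^ 2 * (w ^ 2 * (p ^ 2 + q ^ 2))))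
        + L / 2 * (η ^ 2 * (w ^ 2 * (p ^ 2 + q ^ 2)))
        + L / 4 * (98 / 9 * (η ^ 2 * (w ^ 2 * (p ^ 2 + q ^ 2)))) := by
        have hd2 : γ / 2 * (η ^ 2 * d) ≤ L / 2 * (η ^ 2 * (w ^ 2 * (p ^ 2 + q ^ 2))) := by
          calc _ ≤ γ / 2 * (η ^ 2 * (w ^ 2 * (p ^ 2 + q ^ 2))) := by gcongr
            _ ≤ _ := by gcongr
        gcongr
    -- `55/12 = 49/36 + 1/2 + 49/18`, well below the `15` granted by the step-size rule.
    _ = η * (p ^ 2 + q ^ 2) * (η * (g / 2 + 55 / 12 * (L * w ^ 2)) - 1) := by ring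
    _ ≤ η * (p ^ 2 + q ^ 2) * (η * (15 * L * w ^ 2 + 3 * g) - 1) := by
        have h2 : 0 ≤ L * w ^ 2 := by positivity
        have h3 : g / 2 + 55 / 12 * (L * w ^ 2) ≤ 15 * L * w ^ 2 + 3 * g := by linarith
        gcongr
    _ ≤ 0 := mul_nonpos_of_nonneg_of_nonpos (by positivity) (by linarith)

/-- The Frobenius norm of the second-order term in a product of two perturbed factors. -/
lemma frobNorm_step_le {α β ρ : Type*} [Fintype α] [Fintype β] [Fintype ρ] [DecidableEq α]
    [DecidableEq β] [DecidableEq ρ] {P U : Matrix α ρ ℝ} {Q V : Matrix β ρ ℝ} {η w : ℝ}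
    (hη : 0 ≤ η) (hU : specNorm U ≤ w) (hV : specNorm V ≤ w)
    (hP : η * specNorm P ≤ w / 3) (hQ : η * specNorm Q ≤ w / 3) :
    frobNorm (-η • (P * Vᵀ + U * Qᵀ) + η ^ 2 • (P * Qᵀ)) ≤
      7 / 6 * (η * w * (frobNorm P + frobNorm Q)) := by
  have h1 : frobNorm (P * Vᵀ) ≤ frobNorm P * w :=
    (frobNorm_mul_le_right _ _).trans (by
      rw [specNorm_transpose]; exact mul_le_mul_of_nonneg_left hV (frobNorm_nonneg _))
  have h2 : frobNorm (U * Qᵀ) ≤ w * frobNorm Q :=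
    (frobNorm_mul_le_left _ _).trans (by
      rw [frobNorm_transpose]; exact mul_le_mul_of_nonneg_right hU (frobNorm_nonneg _))
  have h3 : frobNorm (P * Qᵀ) ≤ frobNorm P * specNorm Q := by
    simpa only [specNorm_transpose] using frobNorm_mul_le_right P Qᵀ
  have h4 : frobNorm (P * Qᵀ) ≤ specNorm P * frobNorm Q := by
    simpa only [frobNorm_transpose] using frobNorm_mul_le_left P Qᵀ
  -- The average of the two bounds `w/3 * |P|` and `w/3 * |Q|`; the extra `1/6` turns the
  -- first-order constant `1` into `7/6`.
  have h5 : η * frobNorm (P * Qᵀ) ≤ w / 6 * (frobNorm P + frobNorm Q) := by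
    have a := mul_le_mul_of_nonneg_left h3 hη
    have b := mul_le_mul_of_nonneg_left h4 hη
    have c := mul_le_mul_of_nonneg_right hP (frobNorm_nonneg Q)
    have d := mul_le_mul_of_nonneg_right hQ (frobNorm_nonneg P)
    linarith
  have h6 := frobNorm_add_le (-η • (P * Vᵀ + U * Qᵀ)) (η ^ 2 • (P * Qᵀ))
  rw [frobNorm_smul, frobNorm_smul, abs_neg, abs_of_nonneg hη, abs_of_nonneg (sq_nonneg η)] at h6
  have h7 := mul_le_mul_of_nonneg_left (frobNorm_add_le (P * Vᵀ) (U * Qᵀ)) hη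
  have h8 := mul_le_mul_of_nonneg_left h1 hη
  have h9 := mul_le_mul_of_nonneg_left h2 hη
  have h10 := mul_le_mul_of_nonneg_left h5 hη
  linarith

lemma trInner_mul_transpose_mul {α ρ σ : Type*} [Fintype α] [Fintype ρ] [Fintype σ]
    (U : Matrix σ ρ ℝ) (P : Matrix α ρ ℝ) :
    trInner (Uᵀ * U) (Pᵀ * P) = frobNorm (P * Uᵀ) ^ 2 := by
  rw [← trInner_self, trInner_mul_left, trInner_mul_right, Matrix.transpose_transpose,
    Matrix.transpose_transpose, Matrix.mul_assoc, trInner_comm]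

/-- A short step of Rule 2 does not increase the merit function. -/
lemma balancedObjective_rule2_le {f : Matrix (Fin m) (Fin n) ℝ → ℝ} {L γ η : ℝ}
    {U : Matrix (Fin m) (Fin r) ℝ} {V : Matrix (Fin n) (Fin r) ℝ}
    (hf : ∀ X Y, f Y ≤ f X + trInner (matGrad f X) (Y - X) + L / 2 * frobNorm (Y - X) ^ 2)
    (hγ : 0 ≤ γ) (hγL : γ ≤ L) (hη : 0 < η)
    (hstep : η * (15 * L * specNorm (Matrix.fromRows U V) ^ 2
      + 3 * specNorm (matGrad f (U * Vᵀ))) ≤ 1) :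
    balancedObjective f γ (rule2 f γ η U V).1 (rule2 f γ η U V).2 ≤ balancedObjective f γ U V := by
  simp only [rule2, balancedObjective]
  set G := matGrad f (U * Vᵀ) with hG
  set D := Uᵀ * U - Vᵀ * V with hD
  set P := G * V + γ • (U * D) with hP
  set Q := Gᵀ * U - γ • (V * D) with hQ
  set w := specNorm (Matrix.fromRows U V) with hw
  have hw0 : 0 ≤ w := specNorm_nonneg _
  have hg0 : 0 ≤ specNorm G := specNorm_nonneg _
  have hU : specNorm U ≤ w := specNorm_top_le_fromRows U V
  have hV : specNorm V ≤ w := specNorm_bot_le_fromRows U V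
  have hUn := specNorm_nonneg U
  have hVn := specNorm_nonneg V
  have hDw : specNorm D ≤ 2 * w ^ 2 := by
    refine (specNorm_sub_le _ _).trans ?_
    rw [specNorm_transpose_mul_self, specNorm_transpose_mul_self]
    nlinarith
  have hDt : Dᵀ = D := by simp [hD]
  -- Here `γ ≤ L` lets the smoothness part of the step-size bound pay for the balancing term.
  have hstep' : η * (specNorm G + γ * (2 * w ^ 2)) ≤ 1 / 3 := by
    have : γ * w ^ 2 ≤ L * w ^ 2 := by gcongr
    have h0 : 0 ≤ γ * w ^ 2 := by positivity
    have := mul_le_mul_of_nonneg_left (show 3 * (specNorm G + γ * (2 * w ^ 2)) ≤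
      15 * L * w ^ 2 + 3 * specNorm G by linarith) hη.le
    linarith
  have hPs : η * specNorm P ≤ w / 3 := by
    have h1 : specNorm P ≤ specNorm G * w + γ * (w * (2 * w ^ 2)) := by
      refine (specNorm_add_le _ _).trans ?_
      rw [specNorm_smul, abs_of_nonneg hγ]
      gcongr
      · exact (specNorm_mul_le _ _).trans (by gcongr)
      · exact (specNorm_mul_le _ _).trans (by gcongr; exact specNorm_nonneg _)
    calc η * specNorm P ≤ η * (specNorm G * w + γ * (w * (2 * w ^ 2))) := by gcongr
      _ = η * (specNorm G + γ * (2 * w ^ 2)) * w := by ring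
      _ ≤ 1 / 3 * w := by gcongr
      _ = w / 3 := by ring
  have hQs : η * specNorm Q ≤ w / 3 := by
    have h1 : specNorm Q ≤ specNorm G * w + γ * (w * (2 * w ^ 2)) := by
      refine (specNorm_sub_le _ _).trans ?_
      rw [specNorm_smul, abs_of_nonneg hγ, ← specNorm_transpose G]
      gcongr
      · exact (specNorm_mul_le _ _).trans (by gcongr; exact specNorm_nonneg _)
      · exact (specNorm_mul_le _ _).trans (by gcongr; exact specNorm_nonneg _)
    calc η * specNorm Q ≤ η * (specNorm G * w + γ * (w * (2 * w ^ 2))) := by gcongr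
      _ = η * (specNorm G + γ * (2 * w ^ 2)) * w := by ring
      _ ≤ 1 / 3 * w := by gcongr
      _ = w / 3 := by ring
  -- the change of the product and the change of the imbalance
  have hX : (U - η • P) * (V - η • Q)ᵀ - U * Vᵀ =
      -η • (P * Vᵀ + U * Qᵀ) + η ^ 2 • (P * Qᵀ) := by
    simp only [Matrix.transpose_sub, Matrix.transpose_smul, Matrix.sub_mul, Matrix.mul_sub,
      Matrix.smul_mul, Matrix.mul_smul]
    module
  have gram : ∀ {k : ℕ} (A B : Matrix (Fin k) (Fin r) ℝ), (A - η • B)ᵀ * (A - η • B) =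
      Aᵀ * A + (-η • (Bᵀ * A + Aᵀ * B) + η ^ 2 • (Bᵀ * B)) := fun A B => by
    simp only [Matrix.transpose_sub, Matrix.transpose_smul, Matrix.sub_mul, Matrix.mul_sub,
      Matrix.smul_mul, Matrix.mul_smul]
    module
  have hE : (U - η • P)ᵀ * (U - η • P) - (V - η • Q)ᵀ * (V - η • Q) =
      D + ((-η • (Pᵀ * U + Uᵀ * P) + η ^ 2 • (Pᵀ * P))
        - (-η • (Qᵀ * V + Vᵀ * Q) + η ^ 2 • (Qᵀ * Q))) := by
    rw [gram, gram, hD]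
    abel
  rw [hE, frobNorm_add_sq]
  have hfX := hf (U * Vᵀ) ((U - η • P) * (V - η • Q)ᵀ)
  rw [hX, ← hG] at hfX
  have hx := frobNorm_step_le hη.le hU hV hPs hQs
  have hUt : specNorm Uᵀ ≤ w := by rwa [specNorm_transpose]
  have hVt : specNorm Vᵀ ≤ w := by rwa [specNorm_transpose]
  have hPt : η * specNorm Pᵀ ≤ w / 3 := by rwa [specNorm_transpose]
  have hQt : η * specNorm Qᵀ ≤ w / 3 := by rwa [specNorm_transpose]
  have he : frobNorm ((-η • (Pᵀ * U + Uᵀ * P) + η ^ 2 • (Pᵀ * P))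
        - (-η • (Qᵀ * V + Vᵀ * Q) + η ^ 2 • (Qᵀ * Q))) ≤
      7 / 3 * (η * w * (frobNorm P + frobNorm Q)) := by
    have h1 := frobNorm_step_le (P := Pᵀ) (U := Uᵀ) (Q := Pᵀ) (V := Uᵀ) hη.le hUt hUt hPt hPt
    have h2 := frobNorm_step_le (P := Qᵀ) (U := Vᵀ) (Q := Qᵀ) (V := Vᵀ) hη.le hVt hVt hQt hQt
    simp only [Matrix.transpose_transpose, frobNorm_transpose] at h1 h2
    refine (frobNorm_sub_le _ _).trans ?_
    linarith
  -- first-order terms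
  have hGX : trInner G (-η • (P * Vᵀ + U * Qᵀ) + η ^ 2 • (P * Qᵀ)) =
      -η * (trInner (G * V) P + trInner (Gᵀ * U) Q) + η ^ 2 * trInner G (P * Qᵀ) := by
    rw [trInner_add_right, trInner_smul_right, trInner_smul_right, trInner_add_right,
      trInner_mul_right G P, Matrix.transpose_transpose, trInner_mul_left G U,
      ← trInner_transpose _ Qᵀ, Matrix.transpose_transpose, Matrix.transpose_mul,
      Matrix.transpose_transpose]
  have sym : ∀ {k : ℕ} (A B : Matrix (Fin k) (Fin r) ℝ),
      trInner D (Bᵀ * A + Aᵀ * B) = 2 * trInner (A * D) B := fun A B => by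
    rw [trInner_add_right, trInner_mul_left D Aᵀ, Matrix.transpose_transpose,
      ← trInner_transpose D, Matrix.transpose_mul, Matrix.transpose_transpose, hDt,
      trInner_mul_left D Aᵀ, Matrix.transpose_transpose]
    ring
  have hDE : trInner D ((-η • (Pᵀ * U + Uᵀ * P) + η ^ 2 • (Pᵀ * P))
        - (-η • (Qᵀ * V + Vᵀ * Q) + η ^ 2 • (Qᵀ * Q))) =
      -η * (2 * trInner (U * D) P - 2 * trInner (V * D) Q)
        + η ^ 2 * trInner D (Pᵀ * P - Qᵀ * Q) := by
    rw [trInner_sub_right, trInner_add_right, trInner_add_right, trInner_smul_right,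
      trInner_smul_right, trInner_smul_right, trInner_smul_right, sym, sym, trInner_sub_right D (Pᵀ * P)]
    ring
  -- `P` and `Q` are the partial gradients of the merit function, so the first-order change is
  -- exactly `-η(|P|² + |Q|²)`.
  have hPP : trInner (G * V) P + γ * trInner (U * D) P = frobNorm P ^ 2 := by
    rw [← trInner_self]
    nth_rw 3 [hP]
    rw [trInner_add_left, trInner_smul_left]
  have hQQ : trInner (Gᵀ * U) Q - γ * trInner (V * D) Q = frobNorm Q ^ 2 := by
    rw [← trInner_self]
    nth_rw 3 [hQ]
    rw [trInner_sub_left, trInner_smul_left]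
  -- second-order terms
  have hc : trInner G (P * Qᵀ) ≤ specNorm G * (frobNorm P * frobNorm Q) := by
    rw [trInner_mul_right, Matrix.transpose_transpose]
    calc trInner (G * Q) P ≤ frobNorm (G * Q) * frobNorm P := trInner_le _ _
      _ ≤ specNorm G * frobNorm Q * frobNorm P := by
        gcongr
        · exact frobNorm_nonneg _
        · exact frobNorm_mul_le_left _ _
      _ = _ := by ring
  have sqle : ∀ {k l : ℕ} (A : Matrix (Fin k) (Fin r) ℝ) (B : Matrix (Fin l) (Fin r) ℝ),
      specNorm B ≤ w → frobNorm (A * Bᵀ) ^ 2 ≤ w ^ 2 * frobNorm A ^ 2 := fun A B hB => by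
    rw [← mul_pow, mul_comm w]
    refine pow_le_pow_left₀ (frobNorm_nonneg _) ((frobNorm_mul_le_right _ _).trans ?_) 2
    rw [specNorm_transpose]
    exact mul_le_mul_of_nonneg_left hB (frobNorm_nonneg _)
  have hd : trInner D (Pᵀ * P - Qᵀ * Q) ≤ w ^ 2 * (frobNorm P ^ 2 + frobNorm Q ^ 2) := by
    rw [trInner_sub_right, hD, trInner_sub_left, trInner_sub_left, trInner_mul_transpose_mul,
      trInner_mul_transpose_mul, trInner_mul_transpose_mul, trInner_mul_transpose_mul]
    -- The mixed terms `|PVᵀ|²` and `|QUᵀ|²` enter with a minus sign and are dropped.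
    nlinarith [sqle P U hU, sqle Q V hV, sq_nonneg (frobNorm (P * Vᵀ)),
      sq_nonneg (frobNorm (Q * Uᵀ))]
  have key := descent_arith (p := frobNorm P) (q := frobNorm Q) hη hγ hγL hg0
    (frobNorm_nonneg _) (frobNorm_nonneg _) hstep hx he hc hd
  rw [hGX] at hfX
  rw [hDE]
  linear_combination hfX + key - η * hPP - η * hQQ

lemma rule1_eq_rule2 (f : Matrix (Fin m) (Fin n) ℝ → ℝ) (η : ℝ)
    (U : Matrix (Fin m) (Fin r) ℝ) (V : Matrix (Fin n) (Fin r) ℝ) :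
    rule1 f η U V = rule2 f 0 η U V := by
  simp [rule1, rule2]

lemma rule2_eq_of_balanced (f : Matrix (Fin m) (Fin n) ℝ → ℝ) (γ η : ℝ)
    {U : Matrix (Fin m) (Fin r) ℝ} {V : Matrix (Fin n) (Fin r) ℝ} (h : Uᵀ * U = Vᵀ * V) :
    rule2 f γ η U V = rule2 f 0 η U V := by
  simp [rule2, h]

end Descent

/-! ### Monotonicity along a run from balanced factors. -/

section Run

variable {m n r : ℕ}

/-- Treating Rule 1 as Rule 2 with weight zero avoids deciding whether `f` is strongly convex. -/
lemma exists_bfgdUpdate_eq_rule2 (f : Matrix (Fin m) (Fin n) ℝ → ℝ) (γ : ℝ) :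
    ∃ γ', (γ' = 0 ∨ γ' = γ) ∧ ∀ (η : ℝ) (U : Matrix (Fin m) (Fin r) ℝ)
      (V : Matrix (Fin n) (Fin r) ℝ), bfgdUpdate f γ η U V = rule2 f γ' η U V := by
  by_cases h : ∃ μ : ℝ, 0 < μ ∧ IsStronglyConvex f μ
  · exact ⟨γ, Or.inr rfl, fun η U V => if_pos h⟩
  · exact ⟨0, Or.inl rfl, fun η U V => (if_neg h).trans (rule1_eq_rule2 f η U V)⟩

/-- Both Gram matrices are the diagonal matrix of the `r` leading singular values, while `|X|₂²`
sums the squares of all of them. -/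
lemma IsSVDFactorization.gram_eq {hr : r ≤ min m n} {X : Matrix (Fin m) (Fin n) ℝ}
    {U : Matrix (Fin m) (Fin r) ℝ} {V : Matrix (Fin n) (Fin r) ℝ}
    (h : IsSVDFactorization hr X U V) :
    Uᵀ * U = Vᵀ * V ∧ frobNorm (Uᵀ * U) ≤ frobNorm X := by
  obtain ⟨A, B, s, hA, hB, hs, -, hX, hU, hV⟩ := h
  have gram : ∀ {k : ℕ} {A : Matrix (Fin k) (Fin (min m n)) ℝ} {U : Matrix (Fin k) (Fin r) ℝ},
      Aᵀ * A = 1 → (∀ i j, U i j = √(s (Fin.castLE hr j)) * A i (Fin.castLE hr j)) →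
      Uᵀ * U = Matrix.diagonal fun j => s (Fin.castLE hr j) := fun {k A U} hA hU => by
    ext j l
    have h1 : (Aᵀ * A) (Fin.castLE hr j) (Fin.castLE hr l) =
        (1 : Matrix _ _ ℝ) (Fin.castLE hr j) (Fin.castLE hr l) := by rw [hA]
    have h2 : (Uᵀ * U) j l = √(s (Fin.castLE hr j)) * √(s (Fin.castLE hr l)) *
        (Aᵀ * A) (Fin.castLE hr j) (Fin.castLE hr l) := by
      simp only [Matrix.mul_apply, Matrix.transpose_apply, hU, Finset.mul_sum]
      exact Finset.sum_congr rfl fun i _ => by ring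
    rw [h2, h1]
    by_cases hjl : j = l
    · subst hjl
      simp [Real.mul_self_sqrt (hs _)]
    · rw [Matrix.diagonal_apply_ne _ hjl, Matrix.one_apply_ne, mul_zero]
      exact fun h => hjl (Fin.castLE_injective hr h)
  refine ⟨(gram hA hU).trans (gram hB hV).symm, ?_⟩
  have iso : ∀ {k l : ℕ} {A : Matrix (Fin k) (Fin (min m n)) ℝ}
      (C : Matrix (Fin (min m n)) (Fin l) ℝ), Aᵀ * A = 1 → frobNorm (A * C) = frobNorm C :=
    fun C hA => by
      refine (pow_left_inj₀ (frobNorm_nonneg _) (frobNorm_nonneg _) two_ne_zero).mp ?_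
      rw [← trInner_self, trInner_mul_left, ← Matrix.mul_assoc, hA, Matrix.one_mul, trInner_self]
  have hdiag : ∀ {k : ℕ} (v : Fin k → ℝ), frobNorm (Matrix.diagonal v) ^ 2 = ∑ i, v i ^ 2 :=
    fun v => by
      rw [frobNorm_sq]
      refine Finset.sum_congr rfl fun i _ => ?_
      rw [Finset.sum_eq_single i] <;> simp +contextual [eq_comm]
  rw [gram hA hU, hX, Matrix.mul_assoc, iso _ hA, ← frobNorm_transpose (_ * _),
    Matrix.transpose_mul, Matrix.transpose_transpose, iso _ hB, Matrix.diagonal_transpose]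
  refine le_of_sq_le_sq ?_ (frobNorm_nonneg _)
  rw [hdiag, hdiag, ← Finset.sum_image (g := Fin.castLE hr) (f := fun k => s k ^ 2)
    (Fin.castLE_injective hr).injOn]
  exact Finset.sum_le_sum_of_subset_of_nonneg (Finset.subset_univ _) fun _ _ _ => sq_nonneg _

lemma frobNorm_mul_transpose_of_gram_eq {U : Matrix (Fin m) (Fin r) ℝ}
    {V : Matrix (Fin n) (Fin r) ℝ} (h : Uᵀ * U = Vᵀ * V) :
    frobNorm (U * Vᵀ) = frobNorm (Uᵀ * U) := by
  refine (pow_left_inj₀ (frobNorm_nonneg _) (frobNorm_nonneg _) two_ne_zero).mp ?_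
  rw [← trInner_mul_transpose_mul, ← h, trInner_self]

/-- Along a run the objective never exceeds its initial value, provided that the weight of the
balancing term is at most the smoothness constant or that there is at most one step. -/
lemma IsBFGDRun.apply_le {f : Matrix (Fin m) (Fin n) ℝ → ℝ} {hr : r ≤ min m n} {T : ℕ} {γ L : ℝ}
    {η : ℕ → ℝ} {U : ℕ → Matrix (Fin m) (Fin r) ℝ} {V : ℕ → Matrix (Fin n) (Fin r) ℝ}
    (hrun : IsBFGDRun f hr T γ 1 L η U V)
    (hf : ∀ X Y, f Y ≤ f X + trInner (matGrad f X) (Y - X) + L / 2 * frobNorm (Y - X) ^ 2)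
    (hγ : 0 ≤ γ) (hL : 0 ≤ L) (h : γ ≤ L ∨ T ≤ 1) :
    f (U T * (V T)ᵀ) ≤ f (U 0 * (V 0)ᵀ) := by
  obtain ⟨γ', hγ', hupd⟩ := exists_bfgdUpdate_eq_rule2 (r := r) f γ
  have hbal := hrun.init.gram_eq.1
  -- along rule 2 with some weight the merit function decreases, and it bounds the objective
  have main : ∀ δ : ℝ, 0 ≤ δ → δ ≤ L →
      (∀ i < T, (U (i + 1), V (i + 1)) = rule2 f δ (η i) (U i) (V i)) →
      f (U T * (V T)ᵀ) ≤ f (U 0 * (V 0)ᵀ) := fun δ hδ hδL hstep => by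
    have hmon : ∀ i ≤ T, balancedObjective f δ (U i) (V i) ≤ balancedObjective f δ (U 0) (V 0) := by
      intro i
      induction i with
      | zero => exact fun _ => le_rfl
      | succ i ih =>
        intro hi
        have h1 := hstep i hi
        have h2 := balancedObjective_rule2_le hf hδ hδL (hrun.step_pos i hi) (hrun.step_le i hi)
        rw [← h1] at h2
        exact h2.trans (ih (Nat.le_of_succ_le hi))
    have h0 : balancedObjective f δ (U 0) (V 0) = f (U 0 * (V 0)ᵀ) := by
      simp [balancedObjective, hbal, frobNorm]
    calc f (U T * (V T)ᵀ) ≤ balancedObjective f δ (U T) (V T) :=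
          le_add_of_nonneg_right (by positivity)
      _ ≤ f (U 0 * (V 0)ᵀ) := (hmon T le_rfl).trans_eq h0
  have hupd' : ∀ i < T, (U (i + 1), V (i + 1)) = rule2 f γ' (η i) (U i) (V i) := fun i hi =>
    (hrun.update i hi).trans (hupd _ _ _)
  rcases h with h | h
  · refine main γ' ?_ ?_ hupd' <;> rcases hγ' with rfl | rfl <;> first | exact le_rfl | assumption
  · refine main 0 le_rfl hL fun i hi => ?_
    -- The only possible step starts from balanced factors, where the weight is irrelevant; weight
    -- zero meets `0 ≤ L` without any lower bound on `L`.
    obtain rfl : i = 0 := by omega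
    rw [hupd' 0 hi, rule2_eq_of_balanced f γ' (η 0) hbal]

end Run

/-! ### Consequences of the initialization condition. -/

section Initialization

variable {m n r : ℕ}

/-- The slack `δ` spares a proof that the infimum is attained. -/
lemma exists_equallyFooted_of_Dist_le {U : Matrix (Fin m) (Fin r) ℝ} {V : Matrix (Fin n) (Fin r) ℝ}
    {X : Matrix (Fin m) (Fin n) ℝ} {c δ : ℝ} (hc : 0 ≤ c) (hδ : 0 < δ)
    (h : Dist U V X ≤ ENNReal.ofReal c) :
    ∃ p ∈ equallyFooted r X, frobNorm (U - p.1) ≤ c + δ ∧ frobNorm (V - p.2) ≤ c + δ := by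
  have hlt : Dist U V X < ENNReal.ofReal (c + δ) :=
    h.trans_lt ((ENNReal.ofReal_lt_ofReal_iff (by linarith)).mpr (by linarith))
  simp only [Dist, iInf_lt_iff] at hlt
  obtain ⟨p, hp, hpd⟩ := hlt
  have h1 : frobNorm (Matrix.fromRows U V - Matrix.fromRows p.1 p.2) < c + δ :=
    (ENNReal.ofReal_lt_ofReal_iff (by linarith)).mp hpd
  have h2 : Matrix.fromRows U V - Matrix.fromRows p.1 p.2 =
      Matrix.fromRows (U - p.1) (V - p.2) := by
    ext (i | i) j <;> simp
  rw [h2] at h1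
  have h3 := frobNorm_fromRows_sq (U - p.1) (V - p.2)
  have h4 := frobNorm_nonneg (Matrix.fromRows (U - p.1) (V - p.2))
  refine ⟨p, hp, (le_of_sq_le_sq ?_ h4).trans h1.le, (le_of_sq_le_sq ?_ h4).trans h1.le⟩
  · linarith [sq_nonneg (frobNorm (V - p.2))]
  · linarith [sq_nonneg (frobNorm (U - p.1))]

/-- The initialization condition bounds the initial error and the `r`-th singular value of the
target by the size of the initial factors. -/
lemma initial_error_le {U : Matrix (Fin m) (Fin r) ℝ} {V : Matrix (Fin n) (Fin r) ℝ}
    {X : Matrix (Fin m) (Fin n) ℝ} {S : ℝ} (hr : 0 < r) (hS : 0 < S)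
    (hU : specNorm U ^ 2 ≤ S) (hV : specNorm V ^ 2 ≤ S)
    (h : Dist U V X ≤ ENNReal.ofReal (√2 * √(sigma X r) / 10)) :
    frobNorm (U * Vᵀ - X) ≤ 2 / 5 * S ∧ sigma X r ≤ 7 / 5 * S := by
  set s := √S with hs
  have hs0 : 0 < s := Real.sqrt_pos.mpr hS
  have hsS : s ^ 2 = S := Real.sq_sqrt hS.le
  obtain ⟨⟨P, Q⟩, ⟨hPQ, hsig⟩, hdU, hdV⟩ :=
    exists_equallyFooted_of_Dist_le (by positivity) (show 0 < s / 100 by positivity) h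
  simp only at hPQ hsig hdU hdV
  set q := √(sigma X r) with hq
  have hq2 : q ^ 2 = sigma X r := Real.sq_sqrt (sigma_nonneg X r)
  have hq0 : 0 ≤ q := Real.sqrt_nonneg _
  obtain ⟨hqP, -⟩ := hsig ⟨r - 1, by omega⟩
  simp only [Nat.sub_add_cancel hr] at hqP
  have hqP' : q ≤ specNorm P := hqP.symm.trans_le (sigma_le_specNorm P r)
  have hUs : specNorm U ≤ s := Real.le_sqrt_of_sq_le hU
  have hVs : specNorm V ≤ s := Real.le_sqrt_of_sq_le hV
  set d := √2 * q / 10 + s / 100 with hd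
  have hP : specNorm P ≤ s + d := by
    have h1 := specNorm_sub_le U (U - P)
    rw [sub_sub_cancel] at h1
    linarith [specNorm_le_frobNorm (U - P)]
  have hQ : specNorm Q ≤ s + d := by
    have h1 := specNorm_sub_le V (V - Q)
    rw [sub_sub_cancel] at h1
    linarith [specNorm_le_frobNorm (V - Q)]
  have h2 : √2 ≤ 1.415 := Real.sqrt_le_left (by norm_num) |>.mpr (by norm_num)
  -- The bound is circular: `d` involves `q`, and `q ≤ ‖P‖ ≤ s + d`. The factor `√2/10 < 1` allows
  -- solving for `d`: `0.1515 / 0.8585 < 0.1765`.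
  have hds : d ≤ 0.1765 * s := by
    have : √2 * q ≤ 1.415 * (s + d) := mul_le_mul h2 (hqP'.trans hP) hq0 (by norm_num)
    linarith
  have hd0 : 0 ≤ d := by positivity
  constructor
  · have e : U * Vᵀ - X = (U - P) * Qᵀ + U * (V - Q)ᵀ := by
      rw [← hPQ, Matrix.transpose_sub, Matrix.sub_mul, Matrix.mul_sub]
      abel
    calc frobNorm (U * Vᵀ - X) ≤ frobNorm ((U - P) * Qᵀ) + frobNorm (U * (V - Q)ᵀ) := by
          rw [e]; exact frobNorm_add_le _ _
      _ ≤ frobNorm (U - P) * specNorm Qᵀ + specNorm U * frobNorm (V - Q)ᵀ :=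
          add_le_add (frobNorm_mul_le_right _ _) (frobNorm_mul_le_left _ _)
      _ ≤ d * (s + d) + s * d := by
          rw [specNorm_transpose, frobNorm_transpose]
          gcongr
          · exact specNorm_nonneg _
          · exact frobNorm_nonneg _
      _ ≤ (0.1765 * s) * (s + 0.1765 * s) + s * (0.1765 * s) := by gcongr
      _ ≤ 2 / 5 * S := by rw [← hsS]; nlinarith [sq_nonneg s]
  · have h3 : q ≤ 1.1765 * s := by linarith
    rw [← hq2, ← hsS]
    nlinarith

end Initialization

/-! ### The starting value of the objective, and the main theorem. -/

variable {m n r : ℕ}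

/-- The factors of the initial point and the initial point itself are of size at most
`√(mn) / L̂`. -/
lemma initial_size_le {M : Matrix (Fin m) (Fin n) ℝ} {τ lam : ℝ} (hτ : τ ≠ 0)
    (hL : 0 < 1 / τ + lam) {hr : r ≤ min m n}
    {U : Matrix (Fin m) (Fin r) ℝ} {V : Matrix (Fin n) (Fin r) ℝ}
    (h : IsSVDFactorization hr ((1 / (1 / τ + lam)) • (-matGrad (objective M τ lam) 0)) U V) :
    specNorm U ^ 2 ≤ √(m * n) / (1 / τ + lam) ∧ specNorm V ^ 2 ≤ √(m * n) / (1 / τ + lam) ∧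
      frobNorm (U * Vᵀ) ≤ √(m * n) / (1 / τ + lam) := by
  obtain ⟨hbal, hle⟩ := h.gram_eq
  have h1 : frobNorm (Uᵀ * U) ≤ √(m * n) / (1 / τ + lam) := by
    refine hle.trans ?_
    rw [frobNorm_smul, frobNorm_neg, abs_of_pos (by positivity), one_div_mul_eq_div]
    gcongr
    exact frobNorm_matGrad_objective_zero_le M hτ lam
  refine ⟨?_, ?_, (frobNorm_mul_transpose_of_gram_eq hbal).trans_le h1⟩
  · rw [← specNorm_transpose_mul_self]
    exact (specNorm_le_frobNorm _).trans h1
  · rw [← specNorm_transpose_mul_self, ← hbal]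
    exact (specNorm_le_frobNorm _).trans h1

/-- A point of size `√(mn) / L̂` that is within `2/5 √(mn) / L̂` of `Y` has an objective value that
is not much larger than that of `Y`. -/
lemma objective_le_of_close {M X Y : Matrix (Fin m) (Fin n) ℝ} {τ lam : ℝ} (hτ : 0 < τ)
    (hlam : 0 ≤ lam) (hX : frobNorm X ≤ √(m * n) / (1 / τ + lam))
    (hXY : frobNorm (X - Y) ≤ 2 / 5 * (√(m * n) / (1 / τ + lam))) :
    objective M τ lam X ≤ objective M τ lam Y + m * n * τ := by
  set L := 1 / τ + lam with hL
  have hL0 : 0 < L := by positivity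
  have hmn : √((m : ℝ) * n) ^ 2 = m * n := Real.sq_sqrt (by positivity)
  have hmn0 : 0 ≤ (m : ℝ) * n := by positivity
  have hLτ : 1 / L ≤ τ := by
    rw [div_le_iff₀ hL0, hL, mul_add, mul_one_div_cancel hτ.ne']
    linarith [mul_nonneg hτ.le hlam]
  -- AM-GM: `(1/τ + λ)² ≥ 4λ/τ`.
  have hlamL : lam / L ^ 2 ≤ τ / 4 := by
    rw [div_le_iff₀ (by positivity), hL]
    have e : τ / 4 * (1 / τ + lam) ^ 2 = lam + τ / 4 * (1 / τ - lam) ^ 2 := by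
      field_simp
      ring
    rw [e]
    exact le_add_of_nonneg_right (by positivity)
  have h1 : charbonnierMat (M - X) τ ≤ charbonnierMat (M - Y) τ + 2 / 5 * (m * n * τ) := by
    refine (charbonnierMat_le_add_l1Norm hτ (M - X) (M - Y)).trans ?_
    gcongr
    refine (l1Norm_le_sqrt_mul_frobNorm _).trans ?_
    rw [show M - X - (M - Y) = -(X - Y) by abel, frobNorm_neg]
    calc √(m * n) * frobNorm (X - Y) ≤ √(m * n) * (2 / 5 * (√(m * n) / L)) := by gcongr
      _ = 2 / 5 * (√(m * n) ^ 2 * (1 / L)) := by ring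
      _ ≤ 2 / 5 * (m * n * τ) := by rw [hmn]; gcongr
  have h2 : lam / 2 * frobNorm X ^ 2 ≤ 1 / 8 * (m * n * τ) := by
    calc lam / 2 * frobNorm X ^ 2 ≤ lam / 2 * (√(m * n) / L) ^ 2 := by
          have := frobNorm_nonneg X
          gcongr
      _ = √(m * n) ^ 2 / 2 * (lam / L ^ 2) := by rw [div_pow]; ring
      _ ≤ √(m * n) ^ 2 / 2 * (τ / 4) := by gcongr
      _ = 1 / 8 * (m * n * τ) := by rw [hmn]; ring
  have h3 : 0 ≤ lam / 2 * frobNorm Y ^ 2 := by positivity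
  have h4 : 0 ≤ (m : ℝ) * n * τ := by positivity
  simp only [objective]
  linarith

end LowRankL1
end

theorem theorem5p1 :
    ∃ K : ℝ, 0 < K ∧
      ∀ (m n r : ℕ) (hr : r ≤ min m n) (M : Matrix (Fin m) (Fin n) ℝ) (ε τ lam : ℝ)
        -- an optimal pair of the `ℓ₁` problem and an optimal pair of the smoothed problem
        (Ustar : Matrix (Fin m) (Fin r) ℝ) (Vstar : Matrix (Fin n) (Fin r) ℝ)
        (Uhat : Matrix (Fin m) (Fin r) ℝ) (Vhat : Matrix (Fin n) (Fin r) ℝ)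
        -- the iterates and step sizes of the algorithm
        (T : ℕ) (η : ℕ → ℝ)
        (U : ℕ → Matrix (Fin m) (Fin r) ℝ) (V : ℕ → Matrix (Fin n) (Fin r) ℝ),
        0 < ε →
        0 < LowRankL1.OPT r M →
        LowRankL1.l1Norm (M - Ustar * Vstarᵀ) = LowRankL1.OPT r M →
        Ustar * Vstarᵀ ≠ 0 →
        τ = ε * LowRankL1.OPT r M / (3 * m * n) →
        lam = 2 * ε * LowRankL1.OPT r M / (3 * LowRankL1.frobNorm (Ustar * Vstarᵀ) ^ 2) →
        LowRankL1.IsFactorMinimizer (LowRankL1.objective M τ lam) Uhat Vhat →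
        LowRankL1.IsBFGDRun (LowRankL1.objective M τ lam) hr T (1 / 4) 1 (1 / τ + lam) η U V →
        LowRankL1.Dist (U 0) (V 0) (Uhat * Vhatᵀ) ≤
          ENNReal.ofReal
            (Real.sqrt 2 * Real.sqrt (LowRankL1.sigma (Uhat * Vhatᵀ) r) / 10) →
        -- the number of iterations
        (T = ⌈K * (LowRankL1.sigma (Uhat * Vhatᵀ) r *
              (m * n / (ε * LowRankL1.OPT r M) ^ 2
                + 1 / LowRankL1.frobNorm (Ustar * Vstarᵀ) ^ 2))⌉₊ ∨
          (1 / 4 ≤ 1 / τ + lam ∧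
            K * (LowRankL1.sigma (Uhat * Vhatᵀ) r *
              (m * n / (ε * LowRankL1.OPT r M) ^ 2
                + 1 / LowRankL1.frobNorm (Ustar * Vstarᵀ) ^ 2)) ≤ T)) →
        LowRankL1.l1Norm (M - U T * (V T)ᵀ) ≤ (1 + ε) * LowRankL1.OPT r M := by
  open LowRankL1 in
  -- `K` matters only when `L < 1/4`, where `B ≤ 7/10 * L` leaves ample room for `K = 1`.
  refine ⟨1, one_pos, ?_⟩
  intro m n r hr M ε τ lam Ustar Vstar Uhat Vhat T η U V hε hOPT hopt hne hτ hlam hmin hrun hdist hT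
  -- the dimensions are positive
  have hm : 0 < m := Nat.pos_of_ne_zero fun h => hne (by subst h; exact Subsingleton.elim _ _)
  have hn : 0 < n := Nat.pos_of_ne_zero fun h => hne (by subst h; exact Subsingleton.elim _ _)
  have hr0 : 0 < r := Nat.pos_of_ne_zero fun h => hne (by
    subst h
    ext i j
    simp [Matrix.mul_apply])
  have hN : 0 < frobNorm (Ustar * Vstarᵀ) := by
    refine (frobNorm_nonneg _).lt_of_ne fun h => hne ?_
    have h1 : toVec (Ustar * Vstarᵀ) = 0 := norm_eq_zero.mp ((frobNorm_eq_norm _).symm.trans h.symm)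
    ext i j
    exact congrFun (congrArg WithLp.ofLp h1) (i, j)
  set N := frobNorm (Ustar * Vstarᵀ) with hNdef
  set e := ε * OPT r M with he
  have he0 : 0 < e := mul_pos hε hOPT
  have hm' : (0 : ℝ) < m := Nat.cast_pos.mpr hm
  have hn' : (0 : ℝ) < n := Nat.cast_pos.mpr hn
  have hmn1 : (1 : ℝ) ≤ m * n := by exact_mod_cast Nat.mul_pos hm hn
  have hτ0 : 0 < τ := by rw [hτ]; positivity
  have hlam0 : 0 < lam := by rw [hlam, mul_assoc]; positivity
  have hmnτ : m * n * τ = e / 3 := by rw [hτ]; field_simp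
  set L := 1 / τ + lam with hL
  have hL0 : 0 < L := by positivity
  set f := objective M τ lam with hf
  obtain ⟨hU0, hV0, hX0⟩ := initial_size_le hτ0.ne' hL0 hrun.init
  obtain ⟨herr, hsig⟩ := initial_error_le hr0 (by positivity) hU0 hV0 hdist
  -- the number of steps is admissible for the descent argument
  have hsteps : 1 / 4 ≤ L ∨ T ≤ 1 := by
    by_contra! hcon
    obtain ⟨hL4, hT1⟩ := hcon
    rcases hT with hT | hT
    · refine absurd hT1 (not_lt.mpr ?_)
      rw [hT, one_mul]
      refine Nat.ceil_le.mpr ?_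
      have hS1 : √((m : ℝ) * n) / L ≤ e / 3 := by
        rw [← hmnτ]
        have h1 : √((m : ℝ) * n) ≤ m * n := (Real.sqrt_le_left (by positivity)).mpr (by nlinarith)
        have h2 : 1 / L ≤ τ := by
          rw [div_le_iff₀ hL0, hL, mul_add, mul_one_div_cancel hτ0.ne']
          linarith [mul_pos hτ0 hlam0]
        rw [div_eq_mul_one_div]
        gcongr
      -- Up to constants, the bracket in `B` is `L/e`, while `σ_r(X̂)` is at most of order `e`; so
      -- `B` is at most of order `L`.
      have hLe : m * n / e ^ 2 + 1 / N ^ 2 ≤ 3 / 2 * (L / e) := by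
        have h1 : L / e = 3 * (m * n / e ^ 2) + 2 / 3 * (1 / N ^ 2) := by
          rw [hL, hlam, hτ, mul_assoc 2 ε, ← he]
          field_simp
        have h2 : 0 ≤ m * n / e ^ 2 := by positivity
        rw [h1]
        linarith
      calc sigma (Uhat * Vhatᵀ) r * (m * n / e ^ 2 + 1 / N ^ 2)
          ≤ 7 / 5 * (e / 3) * (3 / 2 * (L / e)) := by
            have : sigma (Uhat * Vhatᵀ) r ≤ 7 / 5 * (e / 3) := hsig.trans (by gcongr)
            gcongr
        _ = 7 / 10 * L := by field_simp; norm_num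
        _ ≤ (1 : ℕ) := by push_cast; linarith
    · linarith [hT.1]
  have hdesc := hrun.apply_le (fun X Y => objective_le_quadratic M hτ0 lam X Y) (by norm_num)
    hL0.le hsteps
  have hclose := objective_le_of_close (M := M) hτ0 hlam0.le hX0 herr
  have hstar : f (Ustar * Vstarᵀ) ≤ OPT r M + e / 3 := by
    have h1 := charbonnierMat_le_l1Norm hτ0 (M - Ustar * Vstarᵀ)
    have h2 : lam / 2 * N ^ 2 = e / 3 := by
      rw [hlam, mul_assoc 2 ε, ← he]
      field_simp
    rw [hf, objective, h2]
    linarith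
  have hfin := l1Norm_le_charbonnierMat_add hτ0 (M - U T * (V T)ᵀ)
  have hreg : charbonnierMat (M - U T * (V T)ᵀ) τ ≤ f (U T * (V T)ᵀ) :=
    le_add_of_nonneg_right (by positivity)
  -- The chain is `|M - X_T|₁ ≤ f(X_T) + e/3 ≤ f(X₀) + e/3 ≤ f(X̂) + 2e/3 ≤ f(X*) + 2e/3 ≤ OPT + e`.
  linarith [hmin Ustar Vstar]
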